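/- Let $(K_n)_{n}$ be a sequence of complete algebraically closed non-archimedean valued fields containing $\mathbb{C}$ as a trivially valued subfield, let $(\varepsilon_n)$ be a sequence of positive real numbers, and let $$\mathscr{A}^{\varepsilon}=\Big\{(a_n)\in\prod_{n}K_n : |a_n|^{\varepsilon_n}\text{ is bounded}\Big\},$$ a $\mathbb{C}$-algebra with projections $\pi_n:\mathscr{A}^{\varepsilon}\to K_n$. Let $X$ be an (integral) quasi-projective variety over $\mathbb{C}$ and let $x_n\in X(K_n)$ for every $n$. An $(\varepsilon_n)$-degeneration of $(x_n)$ is a point $x\in X(\mathscr{A}^{\varepsilon})$ with $\pi_n(x)=x_n$ for all $n$. Let $\overline{X}$ be a compactification of $X$ (an integral proper $\mathbb{C}$-scheme containing $X$ as a dense open subscheme), and let $\partial X$ be $\overline{X}\setminus X$ with its reduced closed subscheme structure. Write $\partial X=D_1\cap\dots\cap D_r$ as a scheme-theoretic intersection of effective Cartier divisors, and for each $D=D_i$ choose a presentation $(s_D,L,s,M,t)$: line bundles $L,M$ on $\overline{X}$ with finite generating families $s=(s_k)$, $t=(t_l)$ of nonzero global sections, an isomorphism $\mathcal{O}(D)\simeq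 L\otimes M^{-1}$, and the meromorphic section $s_D$ of $L\otimes M^{-1}$ corresponding to the canonical section of $\mathcal{O}(D)$. For a valued field $K\supseteq\mathbb{C}$ and $p\in\overline{X}(K)$ put $$\lambda_{D}(p)=\max_k\min_l\log\left|\frac{s_k}{t_l\,s_D}(p)\right|\in\mathbb{R}\cup\{\pm\infty\},\qquad \lambda_{\partial X}(p)=\min_{1\le i\le r}\lambda_{D_i}(p),$$ where $|g(p)|=\infty$ if the rational function $g$ is not regular at $p$. Then, for every such compactification and every such choice of divisors and presentations, an $(\varepsilon_n)$-degeneration of $(x_n)$ exists on $X$ if and only if $\varepsilon_n\lambda_{\partial X}(x_n)$ is bounded above uniformly in $n$. -/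

import Mathlib

open CategoryTheory AlgebraicGeometry TopologicalSpace

noncomputable section

namespace Degeneration

/-! ### The product ring of rescaled valued fields -/

/-- The normed field `K ⊇ ℂ` induces the trivial absolute value on `ℂ`. -/
class TriviallyValued (K : Type) [NormedField K] [Algebra ℂ K] : Prop where
  norm_algebraMap : ∀ c : ℂ, c ≠ 0 → ‖algebraMap ℂ K c‖ = 1

/-- The ring of sequences `(aₙ) ∈ ∏ₙ Kₙ` such that `|aₙ| ^ εₙ` is bounded, as a `ℂ`-algebra. -/
def boundedProduct (K : ℕ → Type) [∀ n, NormedField (K n)] [∀ n, IsUltrametricDist (K n)]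
    [∀ n, Algebra ℂ (K n)] [∀ n, TriviallyValued (K n)] (ε : ℕ → ℝ) (hε : ∀ n, 0 < ε n) :
    Subalgebra ℂ (∀ n, K n) where
  carrier := {a | ∃ C : ℝ, ∀ n, ‖a n‖ ^ ε n ≤ C}
  mul_mem' := by
    rintro a b ⟨C, hC⟩ ⟨D, hD⟩
    refine ⟨C * D, fun n => ?_⟩
    rw [Pi.mul_apply, norm_mul, Real.mul_rpow (norm_nonneg _) (norm_nonneg _)]
    exact mul_le_mul (hC n) (hD n) (by positivity) (le_trans (by positivity) (hC n))
  add_mem' := by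
    rintro a b ⟨C, hC⟩ ⟨D, hD⟩
    refine ⟨max C D, fun n => ?_⟩
    have h : ‖(a + b) n‖ ≤ max ‖a n‖ ‖b n‖ := IsUltrametricDist.norm_add_le_max (a n) (b n)
    rcases le_max_iff.mp h with h | h
    · exact le_max_of_le_left
        ((Real.rpow_le_rpow (norm_nonneg _) h (hε n).le).trans (hC n))
    · exact le_max_of_le_right
        ((Real.rpow_le_rpow (norm_nonneg _) h (hε n).le).trans (hD n))
  algebraMap_mem' := by
    intro c
    refine ⟨1, fun n => ?_⟩
    refine Real.rpow_le_one (norm_nonneg _) ?_ (hε n).le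
    change ‖algebraMap ℂ (K n) c‖ ≤ 1
    by_cases hc : c = 0
    · simp [hc]
    · exact (TriviallyValued.norm_algebraMap c hc).le

/-- The projection of the product ring to its `n`-th factor. -/
def boundedProduct.proj (K : ℕ → Type) [∀ n, NormedField (K n)] [∀ n, IsUltrametricDist (K n)]
    [∀ n, Algebra ℂ (K n)] [∀ n, TriviallyValued (K n)] (ε : ℕ → ℝ) (hε : ∀ n, 0 < ε n) (n : ℕ) :
    boundedProduct K ε hε →ₐ[ℂ] K n :=
  (Pi.evalAlgHom ℂ K n).comp (boundedProduct K ε hε).val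

/-! ### Points and quasi-projectivity -/

/-- `X(A)` for a scheme `f : X ⟶ Spec ℂ` and a `ℂ`-algebra `A`:
morphisms `Spec A ⟶ X` over `Spec ℂ`. -/
def Point {X : Scheme.{0}} (f : X ⟶ Spec (.of ℂ)) (A : Type) [CommRing A] [Algebra ℂ A] : Type :=
  {x : Spec (.of A) ⟶ X // x ≫ f = Spec.map (CommRingCat.ofHom (algebraMap ℂ A))}

/-- The map `X(A) → X(B)` induced by a homomorphism `A → B` of `ℂ`-algebras. -/
def Point.map {X : Scheme.{0}} {f : X ⟶ Spec (.of ℂ)} {A B : Type} [CommRing A] [Algebra ℂ A]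
    [CommRing B] [Algebra ℂ B] (φ : A →ₐ[ℂ] B) (x : Point f A) : Point f B :=
  ⟨Spec.map (CommRingCat.ofHom φ.toRingHom) ≫ x.1, by
    rw [Category.assoc, x.2, ← Spec.map_comp, ← CommRingCat.ofHom_comp]
    congr 2
    exact φ.comp_algebraMap⟩

attribute [local instance] MvPolynomial.gradedAlgebra

/-- Projective space `ℙⁿ` over `ℂ`. -/
def projectiveSpace (n : ℕ) : Scheme.{0} :=
  Proj (MvPolynomial.homogeneousSubmodule (Fin (n + 1)) ℂ)

/-- The structure morphism of `ℙⁿ`. -/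
def projectiveSpace.toSpec (n : ℕ) : projectiveSpace n ⟶ Spec (.of ℂ) :=
  Proj.toSpecZero (MvPolynomial.homogeneousSubmodule (Fin (n + 1)) ℂ) ≫
    Spec.map (CommRingCat.ofHom
      (algebraMap ℂ (MvPolynomial.homogeneousSubmodule (Fin (n + 1)) ℂ 0)))

/-- `X` is a locally closed subscheme of some `ℙⁿ` over `ℂ`. -/
def IsQuasiProjective {X : Scheme.{0}} (f : X ⟶ Spec (.of ℂ)) : Prop :=
  ∃ (n : ℕ) (i : X ⟶ projectiveSpace n), IsImmersion i ∧ i ≫ projectiveSpace.toSpec n = f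

/-! ### Line bundles, Cartier divisors and closed subschemes of an integral scheme -/

/-- A line bundle on an integral scheme, realized as an invertible subsheaf of the constant sheaf
of rational functions and given by its stalks; every line bundle on an integral scheme is
isomorphic to one of these. Taking `D` to `𝒪(-D)`, these are also exactly the Cartier divisors
on `X`: a generator at `x` is a local equation of the divisor at `x`. -/
structure LineBundle (X : Scheme.{0}) [IsIntegral X] where
  stalk : ∀ x : X, Submodule (X.presheaf.stalk x) X.functionField
  exists_generator : ∀ x : X, ∃ U : X.Opens, x ∈ U ∧ ∃ e : X.functionField, e ≠ 0 ∧
    ∀ y ∈ U, stalk y = Submodule.span (X.presheaf.stalk y) {e}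

/-- A finite family of nonzero global sections of `L` that generates `L` at every point (for
instance a basis of the space of global sections of a basepoint free line bundle). -/
structure GeneratingSections {X : Scheme.{0}} [IsIntegral X] (L : LineBundle X) where
  num : ℕ
  sec : Fin num → X.functionField
  ne_zero : ∀ k, sec k ≠ 0
  span_eq : ∀ x : X, Submodule.span (X.presheaf.stalk x) (Set.range sec) = L.stalk x

/-- A presentation `(s_D, L, s, M, t)` of the Cartier divisor `D` (given through `𝒪(-D)`):
basepoint free line bundles `L` and `M` with generating global sections `s` and `t`, an isomorphism
`𝒪(D) ≅ L ⊗ M⁻¹`, and the corresponding meromorphic section `s_D` of `L ⊗ M⁻¹`, with divisor `D`.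
Since `s_D` is the image of the canonical section `1` of `𝒪(D)`, the isomorphism is
multiplication by `s_D`; it identifies `M` with `𝒪(-D) ⊗ L`. -/
structure DivisorPresentation {X : Scheme.{0}} [IsIntegral X] (D : LineBundle X) where
  L : LineBundle X
  M : LineBundle X
  s : GeneratingSections L
  t : GeneratingSections M
  sD : X.functionField
  sD_ne_zero : sD ≠ 0
  iso : ∀ x : X, Submodule.span (X.presheaf.stalk x) {sD} * M.stalk x = D.stalk x * L.stalk x

/-- The stalk at `x` of an ideal sheaf, as a submodule of the field of rational functions. -/
def idealStalk {X : Scheme.{0}} [IsIntegral X] (I : X.IdealSheafData) (x : X) :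
    Submodule (X.presheaf.stalk x) X.functionField :=
  Submodule.span (X.presheaf.stalk x)
    {g | ∃ (U : X.affineOpens) (hx : x ∈ U.1) (a : Γ(X, U.1)), a ∈ I.ideal U ∧
      algebraMap (X.presheaf.stalk x) X.functionField (X.presheaf.germ U.1 x hx a) = g}

/-- A presentation of the closed subscheme `Y` with ideal sheaf `I`: finitely many
Cartier divisors `D₁, …, D_r`, each with a presentation, such that `Y` is the scheme-theoretic
intersection `D₁ ∩ ⋯ ∩ D_r`, i.e. `I = 𝒪(-D₁) + ⋯ + 𝒪(-D_r)`.
(In particular the `D_i` are effective.) -/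
structure SubschemePresentation {X : Scheme.{0}} [IsIntegral X] (I : X.IdealSheafData) where
  num : ℕ
  D : Fin num → LineBundle X
  pres : ∀ i, DivisorPresentation (D i)
  iSup_eq : ∀ x : X, ⨆ i, (D i).stalk x = idealStalk I x

/-! ### Local heights -/

/-- The absolute value `|g(p)| ∈ [0, ∞]` of a rational function `g` at a `K`-point `p`: the norm of
the value of `g` at `p` if `g` is regular at `p`, and `∞` (the infimum of the empty set)
otherwise. -/
def absAt {X : Scheme.{0}} [IsIntegral X] {K : Type} [NormedField K]
    (p : Spec (.of K) ⟶ X) (g : X.functionField) : ENNReal :=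
  ⨅ (h : X.presheaf.stalk (p (IsLocalRing.closedPoint K)))
    (_ : algebraMap (X.presheaf.stalk (p (IsLocalRing.closedPoint K))) X.functionField h = g),
    ‖(Scheme.stalkClosedPointTo (R := .of K) p).hom h‖ₑ

/-- The local height `max_k min_l log |s_k / (t_l s_D) (p)|` of a presented Cartier divisor. -/
def DivisorPresentation.height {X : Scheme.{0}} [IsIntegral X] {D : LineBundle X}
    (P : DivisorPresentation D) {K : Type} [NormedField K] (p : Spec (.of K) ⟶ X) : EReal :=
  ⨆ k, ⨅ l, ENNReal.log (absAt p (P.s.sec k / (P.t.sec l * P.sD)))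

/-- The local height of a presented closed subscheme `D₁ ∩ ⋯ ∩ D_r`: the minimum of the local
heights of the presented divisors `D_i`. -/
def SubschemePresentation.height {X : Scheme.{0}} [IsIntegral X] {I : X.IdealSheafData}
    (P : SubschemePresentation I) {K : Type} [NormedField K] (p : Spec (.of K) ⟶ X) : EReal :=
  ⨅ i, (P.pres i).height p

/-- The ideal sheaf of the boundary of an open subscheme `j : X ⟶ X'`: the complement of `X`
with its reduced closed subscheme structure. -/
def boundary {X X' : Scheme.{0}} (j : X ⟶ X') [IsOpenImmersion j] : X'.IdealSheafData :=
  Scheme.IdealSheafData.vanishingIdeal j.opensRange.compl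

end Degeneration

end

noncomputable section

namespace Degeneration

/-! ### Heights in terms of a local equation -/

/-! The sequence always degenerates in `X'`; the height bound decides whether the limit point avoids
the boundary.

Since `X'` is proper and `ℂ` is trivially valued, each point `p n` of `X'` extends over the ring of
integers of `K n` and has a center `c n` (`exists_isCenter`), at which every germ takes a value of
norm at most `1`. At the center, generating sections have integral coordinates, one of them a unit,
so they do not affect the height: it equals `-log |d(p)|` for a local equation `d`
(`iSup_iInf_log_eq`), and the boundary height is the minimum over the equations `d_i`.

By compactness finitely many affine charts suffice. Partition the indices by a chart containing `c
n`. On each part, evaluation is a ring map to the bounded product, hence a point of `X'`, unique by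
separatedness. It lies in `X` iff the `d_i` generate the unit ideal (`Chart.range_subset_iff`). By
the ultrametric inequality this means that for every `n` some `|d_i(p n)⁻¹| ^ ε n` is at most a
common constant (`restrictedProduct.span_eq_top_iff`), which is the bound on heights. Finally the
parts are glued. -/

/-- If a finite family generates the same submodule of the fraction field of a local domain as a
single nonzero element, then the coordinates of the family are integral and one is a unit. -/
theorem exists_isUnit_coord {R F κ : Type*} [CommRing R] [IsLocalRing R] [Field F] [Algebra R F]
    (hinj : Function.Injective (algebraMap R F)) (s : κ → F) (e : F) (he : e ≠ 0)
    (h : Submodule.span R (Set.range s) = Submodule.span R {e}) :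
    ∃ a : κ → R, (∀ k, s k = algebraMap R F (a k) * e) ∧ ∃ k, IsUnit (a k) := by
  have hs : ∀ k, ∃ a : R, s k = algebraMap R F a * e := fun k => by
    have : s k ∈ Submodule.span R {e} := h ▸ Submodule.subset_span ⟨k, rfl⟩
    obtain ⟨a, ha⟩ := Submodule.mem_span_singleton.mp this
    exact ⟨a, by rw [← ha, Algebra.smul_def]⟩
  choose a ha using hs
  refine ⟨a, ha, ?_⟩
  by_contra! hcon
  -- As in Nakayama's lemma: without a unit coordinate the span lies in `𝔪 e`, which cannot contain
  -- `e`.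
  have hle : Submodule.span R (Set.range s) ≤
      Submodule.map (LinearMap.toSpanSingleton R F e) (IsLocalRing.maximalIdeal R) := by
    rw [Submodule.span_le]
    rintro _ ⟨k, rfl⟩
    exact ⟨a k, hcon k, by simp [Algebra.smul_def, ha]⟩
  have hmem : e ∈ Submodule.span R (Set.range s) := h ▸ Submodule.mem_span_singleton_self e
  obtain ⟨m, hm, hme⟩ := hle hmem
  have : algebraMap R F m = 1 := by
    rw [LinearMap.toSpanSingleton_apply, Algebra.smul_def] at hme
    exact mul_right_cancel₀ he (by rw [hme, one_mul])
  rw [← map_one (algebraMap R F)] at this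
  exact (IsLocalRing.mem_maximalIdeal _).mp hm (hinj this ▸ isUnit_one)

/-- The norm of the value of a unit of a subring of integral elements is `1`. -/
theorem norm_eq_one_of_isUnit {R K : Type*} [CommRing R] [NormedField K] (φ : R →+* K)
    (hφ : ∀ r, ‖φ r‖ ≤ 1) {r : R} (hr : IsUnit r) : ‖φ r‖ = 1 := by
  obtain ⟨v, hv⟩ := hr.exists_right_inv
  have h : ‖φ r‖ * ‖φ v‖ = 1 := by rw [← norm_mul, ← map_mul, hv, map_one, norm_one]
  refine le_antisymm (hφ r) ?_
  nlinarith [hφ v, norm_nonneg (φ r)]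

/-- The local height of a presented divisor, computed with a local equation `δ` of the divisor at
the center `R` of the point: it is `-log |δ|`. -/
theorem iSup_iInf_log_eq {R R' F K κ ι : Type*} [CommRing R] [IsLocalRing R] [CommRing R']
    [Field F] [NormedField K] [Algebra R F] [Algebra R' F]
    (hinj : Function.Injective (algebraMap R F)) (hinj' : Function.Injective (algebraMap R' F))
    (σ : R →+* R') (hσ : ∀ r, algebraMap R' F (σ r) = algebraMap R F r)
    (φ : R' →+* K) [IsLocalHom φ] (hφ : ∀ r, ‖φ (σ r)‖ ≤ 1)
    (s : κ → F) (t : ι → F) (ht : ∀ l, t l ≠ 0) (sD : F) (hsD : sD ≠ 0)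
    (l : F) (hl : l ≠ 0) (m : F) (hm : m ≠ 0)
    (hs : Submodule.span R (Set.range s) = Submodule.span R {l})
    (ht' : Submodule.span R (Set.range t) = Submodule.span R {m})
    (δ : R)
    (iso : Submodule.span R {sD} * Submodule.span R {m} =
      Submodule.span R {algebraMap R F δ} * Submodule.span R {l}) :
    (⨆ k, ⨅ j, ENNReal.log (⨅ (h : R') (_ : algebraMap R' F h = s k / (t j * sD)), ‖φ h‖ₑ)) =
      ENNReal.log (‖φ (σ δ)‖ₑ⁻¹) := by
  obtain ⟨a, ha, k₀, hk₀⟩ := exists_isUnit_coord hinj s l hl hs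
  obtain ⟨b, hb, j₀, hj₀⟩ := exists_isUnit_coord hinj t m hm ht'
  rw [Submodule.span_mul_span, Submodule.span_mul_span, Set.singleton_mul_singleton,
    Set.singleton_mul_singleton] at iso
  -- A one-element family: `sD * m = u * δ * l` with `u` a unit.
  obtain ⟨c, hc, i, hu⟩ := exists_isUnit_coord (κ := Unit) hinj (fun _ => sD * m)
    (algebraMap R F δ * l) (by
      intro h0
      rw [h0, Submodule.span_zero_singleton, Submodule.span_singleton_eq_bot] at iso
      exact mul_ne_zero hsD hm iso) (by simpa using iso)
  replace hc := hc i
  generalize c i = u at hu hc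
  -- Clearing denominators turns regularity of `s k / (t j * sD)` into an equation in `R'`.
  have key : ∀ k j h, algebraMap R' F h = s k / (t j * sD) ↔
      h * (σ (b j) * σ u * σ δ) = σ (a k) := fun k j h => by
    rw [eq_div_iff (mul_ne_zero (ht j) hsD), ← hinj'.eq_iff]
    simp only [map_mul, hσ]
    rw [ha, hb, ← mul_left_inj' hl]
    have : algebraMap R' F h * (algebraMap R F (b j) * m * sD) = algebraMap R' F h *
        (algebraMap R F (b j) * algebraMap R F u * algebraMap R F δ) * l := by
      linear_combination algebraMap R' F h * algebraMap R F (b j) * hc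
    rw [this, mul_left_inj' hl, mul_left_inj' hl]
  have hunit := fun r hr => norm_eq_one_of_isUnit (φ.comp σ) hφ (r := r) hr
  simp only [RingHom.comp_apply] at hunit
  apply le_antisymm
  -- Upper bound: the index `j₀` with `b j₀` a unit serves every `k`. If `φ (σ δ) = 0` the right
  -- side is `⊤`; otherwise locality of `φ` makes `σ δ` a unit and the quotient regular.
  · refine iSup_le fun k => (iInf_le _ j₀).trans (ENNReal.log_le_log ?_)
    by_cases h0 : φ (σ δ) = 0
    · simp [h0]
    · have hδ : IsUnit (σ δ) := isUnit_of_map_unit φ _ (isUnit_iff_ne_zero.mpr h0)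
      obtain ⟨v, hv⟩ := (((hj₀.map σ).mul (hu.map σ)).mul hδ).exists_left_inv
      refine (iInf₂_le (σ (a k) * v) ((key _ _ _).mpr (by rw [mul_assoc, hv, mul_one]))).trans ?_
      have h1 := congrArg (fun z => ‖φ z‖) hv
      simp only [map_mul, norm_mul, hunit _ hj₀, hunit _ hu, one_mul, map_one, norm_one] at h1
      rw [← enorm_inv h0, enorm_le_iff_norm_le, norm_inv, map_mul, norm_mul,
        eq_inv_of_mul_eq_one_left h1]
      exact mul_le_of_le_one_left (by positivity) (hφ _)
  -- Lower bound: `a k₀` has norm `1` and `b j` norm at most `1`, so any regular value has norm at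
  -- least `‖φ (σ δ)‖⁻¹`. Without a regular value the infimum is `∞`.
  · refine le_iSup_of_le k₀ (le_iInf fun j => ENNReal.log_le_log (le_iInf₂ fun h hh => ?_))
    have h1 := congrArg (fun z => ‖φ z‖) ((key _ _ _).mp hh)
    simp only [map_mul, norm_mul, hunit _ hk₀, hunit _ hu, mul_one] at h1
    have h0 : φ (σ δ) ≠ 0 := by
      intro h0
      simp [h0] at h1
    rw [← enorm_inv h0, enorm_le_iff_norm_le, norm_inv, inv_le_iff_one_le_mul₀ (by positivity)]
    calc (1 : ℝ) = ‖φ h‖ * (‖φ (σ (b j))‖ * ‖φ (σ δ)‖) := h1.symm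
      _ ≤ ‖φ h‖ * (1 * ‖φ (σ δ)‖) := by gcongr; exact hφ _
      _ = _ := by ring

/-! ### Centers of points of proper schemes -/

/-- The value at a `K`-point `p` of a section on an open set that contains the image of `p`. -/
def evalAt {X : Scheme.{0}} {K : Type} [NormedField K] (p : Spec (.of K) ⟶ X) {U : X.Opens}
    (hU : p (IsLocalRing.closedPoint K) ∈ U) : Γ(X, U) →+* K :=
  (X.presheaf.germ U _ hU ≫ Scheme.stalkClosedPointTo (R := .of K) p).hom

theorem SpecMap_evalAt_fromSpec {X : Scheme.{0}} {K : Type} [NormedField K]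
    (p : Spec (.of K) ⟶ X) {U : X.Opens} (hU : p (IsLocalRing.closedPoint K) ∈ U)
    (hU' : IsAffineOpen U) :
    Spec.map (CommRingCat.ofHom (evalAt p hU)) ≫ hU'.fromSpec = p := by
  change Spec.map (X.presheaf.germ U _ hU ≫ Scheme.stalkClosedPointTo (R := .of K) p) ≫ _ = p
  rw [Spec.map_comp, Category.assoc]
  change Spec.map (Scheme.stalkClosedPointTo (R := .of K) p) ≫ hU'.fromSpecStalk hU = p
  rw [hU'.fromSpecStalk_eq_fromSpecStalk]
  exact Scheme.Spec_stalkClosedPointTo_fromSpecStalk (R := .of K) p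

/-- The point `c` is the center of the `K`-point `p`: the local ring at `c` maps to the ring of
integers of `K`. -/
def IsCenter {X : Scheme.{0}} {K : Type} [NormedField K] (p : Spec (.of K) ⟶ X) (c : X) : Prop :=
  ∃ h : p (IsLocalRing.closedPoint K) ⤳ c, ∀ r : X.presheaf.stalk c,
    ‖(Scheme.stalkClosedPointTo (R := .of K) p).hom ((X.presheaf.stalkSpecializes h).hom r)‖ ≤ 1

theorem IsCenter.mem {X : Scheme.{0}} {K : Type} [NormedField K] {p : Spec (.of K) ⟶ X} {c : X}
    (hc : IsCenter p c) {U : X.Opens} (hU : c ∈ U) : p (IsLocalRing.closedPoint K) ∈ U :=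
  hc.1.mem_open U.isOpen hU

theorem IsCenter.stalkClosedPointTo_stalkSpecializes_germ {X : Scheme.{0}} {K : Type}
    [NormedField K] {p : Spec (.of K) ⟶ X} {c : X} (hc : IsCenter p c) {U : X.Opens} (hU : c ∈ U)
    (g : Γ(X, U)) :
    (Scheme.stalkClosedPointTo (R := .of K) p).hom
      ((X.presheaf.stalkSpecializes hc.1).hom (X.presheaf.germ U c hU g)) =
      evalAt p (hc.mem hU) g := by
  rw [evalAt, ← X.presheaf.germ_stalkSpecializes hU hc.1]
  rfl

theorem IsCenter.norm_evalAt_le_one {X : Scheme.{0}} {K : Type} [NormedField K]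
    {p : Spec (.of K) ⟶ X} {c : X} (hc : IsCenter p c) {U : X.Opens} (hU : c ∈ U) (g : Γ(X, U)) :
    ‖evalAt p (hc.mem hU) g‖ ≤ 1 := by
  rw [← hc.stalkClosedPointTo_stalkSpecializes_germ hU]
  exact hc.2 _

/-- A morphism from the spectrum of the ring of integers gives a center. -/
theorem isCenter_of_lift {X : Scheme.{0}} {K : Type} [NormedField K] {p : Spec (.of K) ⟶ X}
    (R : ValuationSubring K) (hR : ∀ r : R, ‖(r : K)‖ ≤ 1) (q : Spec (.of R) ⟶ X)
    (hq : Spec.map (CommRingCat.ofHom (algebraMap R K)) ≫ q = p) :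
    IsCenter p (q (IsLocalRing.closedPoint R)) := by
  have h : p (IsLocalRing.closedPoint K) ⤳ q (IsLocalRing.closedPoint R) := by
    rw [← hq]
    exact (IsLocalRing.specializes_closedPoint (R := R)
      (Spec.map (CommRingCat.ofHom (algebraMap R K)) (IsLocalRing.closedPoint K))).map q.continuous
  refine ⟨h, fun r => ?_⟩
  -- Evaluation of germs at the center factors through `R`; this is checked after composing with the
  -- monomorphism `X.fromSpecStalk`.
  have key : X.presheaf.stalkSpecializes h ≫ Scheme.stalkClosedPointTo (R := .of K) p =
      Scheme.stalkClosedPointTo (R := .of R) q ≫ CommRingCat.ofHom (algebraMap R K) := by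
    apply Spec.map_injective
    rw [← cancel_mono (X.fromSpecStalk _), Spec.map_comp, Spec.map_comp, Category.assoc,
      Category.assoc, Scheme.SpecMap_stalkSpecializes_fromSpecStalk]
    exact (Scheme.Spec_stalkClosedPointTo_fromSpecStalk (R := .of K) p).trans
      (hq.symm.trans (congrArg _
        (Scheme.Spec_stalkClosedPointTo_fromSpecStalk (R := .of R) q).symm))
  have := congrArg (fun φ => φ.hom r) key
  simp only [CommRingCat.hom_comp, RingHom.comp_apply] at this
  rw [this]
  exact hR _

/-- Valuative criterion for the ring of integers of `K`: it contains `ℂ` because the valuation is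
trivial there, so the required square exists. -/
theorem exists_isCenter {X : Scheme.{0}} (f : X ⟶ Spec (.of ℂ)) [IsProper f] {K : Type}
    [NormedField K] [IsUltrametricDist K] [Algebra ℂ K] [TriviallyValued K]
    (p : Spec (.of K) ⟶ X) (hp : p ≫ f = Spec.map (CommRingCat.ofHom (algebraMap ℂ K))) :
    ∃ c, IsCenter p c := by
  let R : ValuationSubring K := (NormedField.valuation (K := K)).valuationSubring
  have hR : ∀ r : K, r ∈ R ↔ ‖r‖ ≤ 1 := fun r => by
    rw [Valuation.mem_valuationSubring_iff]
    exact Iff.rfl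
  have hC : ∀ z : ℂ, algebraMap ℂ K z ∈ R := fun z => by
    rw [hR]
    by_cases hz : z = 0
    · simp [hz]
    · exact (TriviallyValued.norm_algebraMap z hz).le
  let i : ℂ →+* R := (algebraMap ℂ K).codRestrict R.toSubring hC
  have hf : ValuativeCriterion.Existence f := by
    have : UniversallyClosed f := inferInstance
    rw [UniversallyClosed.eq_valuativeCriterion] at this
    exact this.1
  obtain ⟨⟨l, hl, -⟩⟩ := hf
    { R := R, K := K, i₁ := p, i₂ := Spec.map (CommRingCat.ofHom i),
      commSq := ⟨by
        rw [hp, ← Spec.map_comp, ← CommRingCat.ofHom_comp]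
        rfl⟩ }
  exact ⟨_, isCenter_of_lift R (fun r => (hR _).mp r.2) l hl⟩

/-! ### Local equations of a presented subscheme -/

theorem algebraMap_stalk_injective {X : Scheme.{0}} [IsIntegral X] (x : X) :
    Function.Injective (algebraMap (X.presheaf.stalk x) X.functionField) :=
  IsFractionRing.injective _ _

theorem algebraMap_stalkSpecializes {X : Scheme.{0}} [IsIntegral X] {x y : X} (h : x ⤳ y)
    (r : X.presheaf.stalk y) :
    algebraMap (X.presheaf.stalk x) X.functionField ((X.presheaf.stalkSpecializes h).hom r) =
      algebraMap (X.presheaf.stalk y) X.functionField r := by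
  obtain ⟨U, hU, g, rfl⟩ := X.presheaf.exists_germ_eq r
  have : Nonempty U := ⟨⟨y, hU⟩⟩
  rw [← CommRingCat.comp_apply, X.presheaf.germ_stalkSpecializes,
    Scheme.algebraMap_germ_eq_germToFunctionField, Scheme.algebraMap_germ_eq_germToFunctionField]

/-- The height of a presented divisor at a point `p` is `-log |d(p)|`, for a local equation `d` of
the divisor at the center of `p`. -/
theorem DivisorPresentation.height_eq {X : Scheme.{0}} [IsIntegral X] {D : LineBundle X}
    (P : DivisorPresentation D) {K : Type} [NormedField K] {p : Spec (.of K) ⟶ X} {c : X}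
    (hc : IsCenter p c) {U : X.Opens} (hU : c ∈ U) (d : Γ(X, U))
    (hd : D.stalk c = Submodule.span (X.presheaf.stalk c)
      {algebraMap (X.presheaf.stalk c) X.functionField (X.presheaf.germ U c hU d)}) :
    P.height p = ENNReal.log (‖evalAt p (hc.mem hU) d‖ₑ⁻¹) := by
  obtain ⟨V, hcV, l, hl, hV⟩ := P.L.exists_generator c
  obtain ⟨W, hcW, m, hm, hW⟩ := P.M.exists_generator c
  have iso := P.iso c
  rw [hd, hV c hcV, hW c hcW] at iso
  rw [← hc.stalkClosedPointTo_stalkSpecializes_germ hU]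
  have : IsLocalHom (Scheme.stalkClosedPointTo (R := .of K) p).hom := inferInstance
  exact iSup_iInf_log_eq (algebraMap_stalk_injective c) (algebraMap_stalk_injective _)
    (X.presheaf.stalkSpecializes hc.1).hom (algebraMap_stalkSpecializes hc.1)
    (Scheme.stalkClosedPointTo (R := .of K) p).hom hc.2 P.s.sec P.t.sec P.t.ne_zero P.sD
    P.sD_ne_zero l hl m hm (by rw [P.s.span_eq, hV c hcV]) (by rw [P.t.span_eq, hW c hcW]) _ iso

/-- An affine chart of `X` with equations of the divisors of a presentation. -/
structure Chart {X : Scheme.{0}} [IsIntegral X] {I : X.IdealSheafData}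
    (P : SubschemePresentation I) where
  U : X.Opens
  isAffineOpen : IsAffineOpen U
  eq : Fin P.num → Γ(X, U)
  stalk_eq : ∀ (y : X) (hy : y ∈ U) (i), (P.D i).stalk y = Submodule.span (X.presheaf.stalk y)
    {algebraMap (X.presheaf.stalk y) X.functionField (X.presheaf.germ U y hy (eq i))}

theorem SubschemePresentation.stalk_le {X : Scheme.{0}} [IsIntegral X] {I : X.IdealSheafData}
    (P : SubschemePresentation I) (x : X) (i) : (P.D i).stalk x ≤ idealStalk I x :=
  P.iSup_eq x ▸ le_iSup (fun i => (P.D i).stalk x) i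

/-- Each `D i` is effective: its generator lies in the ideal stalk, hence in the local ring, and
spreads out to a section. Finitely many such neighborhoods are intersected and shrunk to an affine
one. -/
theorem exists_chart {X : Scheme.{0}} [IsIntegral X] {I : X.IdealSheafData}
    (P : SubschemePresentation I) (x : X) : ∃ c : Chart P, x ∈ c.U := by
  have h : ∀ i, ∃ (V : X.Opens) (hx : x ∈ V) (d : Γ(X, V)), ∀ (y : X) (hy : y ∈ V),
      (P.D i).stalk y = Submodule.span (X.presheaf.stalk y)
        {algebraMap (X.presheaf.stalk y) X.functionField (X.presheaf.germ V y hy d)} := by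
    intro i
    obtain ⟨V, hxV, e, -, hV⟩ := (P.D i).exists_generator x
    have he : e ∈ (⊤ : Submodule (X.presheaf.stalk x) (X.presheaf.stalk x)).map
        (Algebra.linearMap (X.presheaf.stalk x) X.functionField) := by
      have h1 : e ∈ idealStalk I x :=
        P.stalk_le x i (hV x hxV ▸ Submodule.mem_span_singleton_self e)
      refine Submodule.span_le.mpr ?_ h1
      rintro _ ⟨U, hx, a, -, rfl⟩
      exact ⟨_, trivial, rfl⟩
    obtain ⟨r, -, hr⟩ := he
    obtain ⟨W, hxW, d, rfl⟩ := X.presheaf.exists_germ_eq r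
    refine ⟨V ⊓ W, ⟨hxV, hxW⟩, X.presheaf.map (homOfLE inf_le_right).op d, fun y hy => ?_⟩
    have : Nonempty W := ⟨⟨x, hxW⟩⟩
    rw [hV y hy.1, ← hr, X.presheaf.germ_res_apply, Algebra.linearMap_apply,
      Scheme.algebraMap_germ_eq_germToFunctionField, Scheme.algebraMap_germ_eq_germToFunctionField]
  choose V hxV d hd using h
  obtain ⟨U, hU, hxU, hUV⟩ := X.isBasis_affineOpens.exists_subset_of_mem_open
    (a := x) (u := ⋂ i, (V i : Set X)) (Set.mem_iInter.mpr hxV)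
    (isOpen_iInter_of_finite fun i => (V i).isOpen)
  obtain ⟨U, hU, rfl⟩ := hU
  have hle : ∀ i, U ≤ V i := fun i => hUV.trans (Set.iInter_subset _ i)
  refine ⟨⟨U, hU, fun i => X.presheaf.map (homOfLE (hle i)).op (d i), fun y hy i => ?_⟩, hxU⟩
  rw [hd i y (hle i hy), X.presheaf.germ_res_apply]

theorem SubschemePresentation.height_eq {X : Scheme.{0}} [IsIntegral X] {I : X.IdealSheafData}
    (P : SubschemePresentation I) (ch : Chart P) {K : Type} [NormedField K]
    {p : Spec (.of K) ⟶ X} {c : X} (hc : IsCenter p c) (hU : c ∈ ch.U) :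
    P.height p = ⨅ i, ENNReal.log (‖evalAt p (hc.mem hU) (ch.eq i)‖ₑ⁻¹) :=
  iInf_congr fun i => (P.pres i).height_eq hc hU (ch.eq i) (ch.stalk_eq c hU i)

/-- On a chart, the boundary is the common zero locus of the equations. -/
theorem Chart.mem_opensRange_iff {X X' : Scheme.{0}} [IsIntegral X'] {j : X ⟶ X'}
    [IsOpenImmersion j] {P : SubschemePresentation (boundary j)} (ch : Chart P) {y : X'}
    (hy : y ∈ ch.U) :
    y ∈ j.opensRange ↔ ∃ i, IsUnit (X'.presheaf.germ ch.U y hy (ch.eq i)) := by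
  let m : Submodule (X'.presheaf.stalk y) X'.functionField :=
    Submodule.map (Algebra.linearMap (X'.presheaf.stalk y) X'.functionField)
      (IsLocalRing.maximalIdeal _)
  have hm : ∀ r : X'.presheaf.stalk y, algebraMap _ X'.functionField r ∈ m ↔ ¬ IsUnit r := fun r => by
    rw [← mem_nonunits_iff, ← IsLocalRing.mem_maximalIdeal]
    refine ⟨?_, fun hr => ⟨r, hr, rfl⟩⟩
    rintro ⟨r', hr', h⟩
    exact algebraMap_stalk_injective y h ▸ hr'
  -- The ideal stalk is the sum of the stalks of the `D i`, so it lies in the maximal ideal iff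
  -- every equation is a nonunit.
  have h1 : (∃ i, IsUnit (X'.presheaf.germ ch.U y hy (ch.eq i))) ↔
      ¬ idealStalk (boundary j) y ≤ m := by
    rw [← P.iSup_eq y, iSup_le_iff, not_forall]
    refine exists_congr fun i => ?_
    rw [ch.stalk_eq y hy i, Submodule.span_singleton_le_iff_mem, hm, not_not]
  rw [h1, idealStalk, Submodule.span_le]
  constructor
  -- An affine neighborhood inside `X` misses the boundary, so `1` belongs to the ideal there.
  · intro hyj hle
    obtain ⟨_, ⟨U, hU, rfl⟩, hyU, hUj⟩ := X'.isBasis_affineOpens.exists_subset_of_mem_open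
      (a := y) (u := j.opensRange) hyj j.opensRange.isOpen
    refine (hm 1).mp (hle ⟨⟨U, hU⟩, hyU, 1, ?_, by simp⟩) isUnit_one
    rw [boundary, Scheme.IdealSheafData.vanishingIdeal_ideal, PrimeSpectrum.mem_vanishingIdeal]
    intro q hq
    refine (hq (hUj ?_)).elim
    rw [← hU.range_fromSpec]
    exact ⟨q, rfl⟩
  · intro hnot
    by_contra hyj
    apply hnot
    rintro _ ⟨U, hyU, a, ha, rfl⟩
    refine (hm _).mpr fun hunit => ?_
    rw [boundary, Scheme.IdealSheafData.vanishingIdeal_ideal, PrimeSpectrum.mem_vanishingIdeal]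
      at ha
    have hq := U.2.fromSpec_primeIdealOf ⟨y, hyU⟩
    have hmem : ∀ S : Set X', y ∈ S → U.2.fromSpec (U.2.primeIdealOf ⟨y, hyU⟩) ∈ S :=
      fun S hS => hq.symm ▸ hS
    have ha' := ha (U.2.primeIdealOf ⟨y, hyU⟩) (hmem _ hyj)
    have hb : U.2.primeIdealOf ⟨y, hyU⟩ ∈ U.2.fromSpec ⁻¹ᵁ X'.basicOpen a :=
      hmem _ ((X'.mem_basicOpen a y hyU).mpr hunit)
    rw [U.2.fromSpec_preimage_basicOpen] at hb
    exact hb ha'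

/-! ### Jointly injective families and gluing -/

/-- Two morphisms from an affine scheme to a separated scheme agree if they agree after
restriction along a jointly injective family of ring homomorphisms. -/
theorem hom_ext_of_jointly_injective {A : Type} [CommRing A] {ι : Type*} {B : ι → Type}
    [∀ i, CommRing (B i)] (φ : ∀ i, A →+* B i) (hφ : ∀ a, (∀ i, φ i a = 0) → a = 0)
    {Y : Scheme.{0}} [Y.IsSeparated] (g h : Spec (.of A) ⟶ Y)
    (hgh : ∀ i, Spec.map (CommRingCat.ofHom (φ i)) ≫ g = Spec.map (CommRingCat.ofHom (φ i)) ≫ h) :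
    g = h := by
  -- The equalizer is `Spec (A / J)`. Every `φ i` factors through `A / J`, so joint injectivity
  -- forces `J = 0`.
  have hcl : IsClosedImmersion (Limits.equalizer.ι g h) := inferInstance
  obtain ⟨J, e, he⟩ := IsClosedImmersion.Spec_iff.mp hcl
  have hJ : J = ⊥ := by
    rw [eq_bot_iff]
    intro a ha
    refine hφ a fun i => ?_
    have h1 : Spec.map (CommRingCat.ofHom (φ i)) =
        (Limits.equalizer.lift _ (hgh i) ≫ e.hom) ≫
          Spec.map (CommRingCat.ofHom (Ideal.Quotient.mk J)) := by
      rw [Category.assoc, ← he, Limits.equalizer.lift_ι]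
    obtain ⟨ψ, hψ⟩ := Spec.map_surjective (Limits.equalizer.lift _ (hgh i) ≫ e.hom)
    rw [← hψ, ← Spec.map_comp] at h1
    have h2 := congrArg (fun z => z.hom a) (Spec.map_injective h1)
    simp only [CommRingCat.hom_ofHom, CommRingCat.hom_comp, RingHom.comp_apply] at h2
    rw [h2, Ideal.Quotient.eq_zero_iff_mem.mpr ha, map_zero]
  have hiso : IsIso (Spec.map (CommRingCat.ofHom (Ideal.Quotient.mk J))) := by
    have : IsIso (CommRingCat.ofHom (Ideal.Quotient.mk J)) := by
      rw [ConcreteCategory.isIso_iff_bijective]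
      refine ⟨?_, Ideal.Quotient.mk_surjective⟩
      change Function.Injective (Ideal.Quotient.mk J)
      rw [RingHom.injective_iff_ker_eq_bot, Ideal.mk_ker, hJ]
    infer_instance
  have : IsIso (Limits.equalizer.ι g h) := by
    rw [he]
    infer_instance
  exact (cancel_epi (Limits.equalizer.ι g h)).mp (Limits.equalizer.condition g h)

/-- Finitely many morphisms from affine schemes define a morphism from the spectrum of the product
of their rings. -/
theorem exists_desc_Spec_pi {ι : Type} [Finite ι] (B : ι → Type) [∀ i, CommRing (B i)]
    {Y : Scheme.{0}} (z : ∀ i, Spec (.of (B i)) ⟶ Y) :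
    ∃ w : Spec (.of (∀ i, B i)) ⟶ Y,
      ∀ i, Spec.map (CommRingCat.ofHom (Pi.evalRingHom B i)) ≫ w = z i := by
  refine ⟨inv (sigmaSpec fun i => CommRingCat.of (B i)) ≫ Limits.Sigma.desc z, fun i => ?_⟩
  have h := ι_sigmaSpec (fun i => CommRingCat.of (B i)) i
  change Spec.map (CommRingCat.ofHom (Pi.evalRingHom (fun i => CommRingCat.of (B i)) i)) ≫ _ = _
  rw [← h, Category.assoc, IsIso.hom_inv_id_assoc, Limits.Sigma.ι_desc]

/-- A morphism from an affine scheme to a chart avoids the boundary if and only if the equations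
of the chart pull back to generators of the unit ideal. -/
theorem Chart.range_subset_iff {X X' : Scheme.{0}} [IsIntegral X'] {j : X ⟶ X'}
    [IsOpenImmersion j] {P : SubschemePresentation (boundary j)} (ch : Chart P) {B : Type}
    [CommRing B] (χ : Γ(X', ch.U) →+* B) :
    Set.range (Spec.map (CommRingCat.ofHom χ) ≫ ch.isAffineOpen.fromSpec) ⊆ Set.range j ↔
      Ideal.span (Set.range fun i => χ (ch.eq i)) = ⊤ := by
  have h : ∀ b : PrimeSpectrum B,
      (Spec.map (CommRingCat.ofHom χ) ≫ ch.isAffineOpen.fromSpec) b ∈ Set.range j ↔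
        ∃ i, χ (ch.eq i) ∉ b.asIdeal := by
    intro b
    let q : Spec Γ(X', ch.U) := Spec.map (CommRingCat.ofHom χ) b
    have hq : ch.isAffineOpen.fromSpec q ∈ ch.U := by
      have : ch.isAffineOpen.fromSpec q ∈ Set.range ch.isAffineOpen.fromSpec := ⟨q, rfl⟩
      rwa [ch.isAffineOpen.range_fromSpec] at this
    refine (ch.mem_opensRange_iff hq).trans (exists_congr fun i => ?_)
    rw [← X'.mem_basicOpen (ch.eq i) _ hq]
    change q ∈ ch.isAffineOpen.fromSpec ⁻¹ᵁ X'.basicOpen (ch.eq i) ↔ _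
    rw [ch.isAffineOpen.fromSpec_preimage_basicOpen]
    exact Iff.rfl
  rw [Set.range_subset_iff]
  constructor
  · intro hz
    by_contra hne
    obtain ⟨m, hm, hle⟩ := Ideal.exists_le_maximal _ hne
    obtain ⟨i, hi⟩ := (h ⟨m, hm.isPrime⟩).mp (hz _)
    exact hi (hle (Ideal.subset_span ⟨i, rfl⟩))
  · intro htop b
    refine (h b).mpr ?_
    by_contra! hall
    refine b.2.ne_top (top_le_iff.mp (htop ▸ Ideal.span_le.mpr ?_))
    rintro _ ⟨i, rfl⟩
    exact hall i

/-! ### Bounded products over a subset of the indices -/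

section BoundedProduct

variable (K : ℕ → Type) [∀ n, NormedField (K n)] [∀ n, IsUltrametricDist (K n)]
  [∀ n, Algebra ℂ (K n)] [∀ n, TriviallyValued (K n)] (ε : ℕ → ℝ) (hε : ∀ n, 0 < ε n)

/-- The restriction of the product ring to the indices in `S`. -/
def restrictedProduct (S : Set ℕ) : Subring (∀ n : S, K n) :=
  (boundedProduct K ε hε).toSubring.map
    (RingHom.pi fun n : S => Pi.evalRingHom K n)

theorem mem_restrictedProduct (S : Set ℕ) (a : ∀ n : S, K n) :
    a ∈ restrictedProduct K ε hε S ↔ ∃ C : ℝ, ∀ n : S, ‖a n‖ ^ ε n ≤ C := by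
  classical
  constructor
  · rintro ⟨b, ⟨C, hC⟩, rfl⟩
    exact ⟨C, fun n => hC n⟩
  · rintro ⟨C, hC⟩
    -- Extension by zero; the added terms are `0 ^ ε n = 0`, whence `max C 0`.
    refine ⟨fun n => if h : n ∈ S then a ⟨n, h⟩ else 0, ⟨max C 0, fun n => ?_⟩, ?_⟩
    · by_cases h : n ∈ S
      · simpa [h] using Or.inl (hC ⟨n, h⟩)
      · simp [h, Real.zero_rpow (hε n).ne']
    · funext n
      exact dif_pos n.2

/-- Restriction to the indices in `S`. -/
def boundedProduct.restrict (S : Set ℕ) : boundedProduct K ε hε →+* restrictedProduct K ε hε S where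
  toFun a := ⟨fun n => a.1 n, a.1, a.2, rfl⟩
  map_one' := rfl
  map_mul' _ _ := rfl
  map_zero' := rfl
  map_add' _ _ := rfl

/-- The projection of the restricted product to a factor. -/
def restrictedProduct.proj (S : Set ℕ) (n : S) : restrictedProduct K ε hε S →+* K n :=
  (Pi.evalRingHom _ n).comp (restrictedProduct K ε hε S).subtype

/-- Sequences of bounded growth on the parts of a finite partition can be combined. -/
def boundedProduct.merge {ι : Type} [Finite ι] (c : ℕ → ι) :
    (∀ i, restrictedProduct K ε hε {n | c n = i}) →+* boundedProduct K ε hε where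
  toFun a := ⟨fun n => (a (c n)).1 ⟨n, rfl⟩, by
    have h := fun i => (mem_restrictedProduct K ε hε _ _).mp (a i).2
    choose C hC using h
    obtain ⟨D, hD⟩ := (Set.finite_range C).bddAbove
    exact ⟨D, fun n => (hC (c n) ⟨n, rfl⟩).trans (hD ⟨c n, rfl⟩)⟩⟩
  map_one' := rfl
  map_mul' _ _ := rfl
  map_zero' := rfl
  map_add' _ _ := rfl

/-- If `∑ g i * b i = 1`, the ultrametric inequality gives at each `n` a term of norm at least `1`,
so the inverse of that `b i` is bounded by `g i`. Conversely, choose one good index for each `n` and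
let `g k` be the inverse of `b k` where `k` is chosen and `0` elsewhere. -/
theorem restrictedProduct.span_eq_top_iff (S : Set ℕ) {ι : Type} [Finite ι]
    (b : ι → restrictedProduct K ε hε S) :
    Ideal.span (Set.range b) = ⊤ ↔
      ∃ C : ℝ, ∀ n : S, ∃ i, (b i).1 n ≠ 0 ∧ ‖((b i).1 n)⁻¹‖ ^ ε n ≤ C := by
  classical
  have := Fintype.ofFinite ι
  rw [Ideal.eq_top_iff_one, Ideal.mem_span_range_iff_exists_fun]
  constructor
  · rintro ⟨g, hg⟩
    have h := fun i => (mem_restrictedProduct K ε hε S _).mp (g i).2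
    choose C hC using h
    obtain ⟨D, hD⟩ := (Set.finite_range C).bddAbove
    refine ⟨D, fun n => ?_⟩
    have h1 : ∑ i, (g i).1 n * (b i).1 n = 1 := by
      have := congrArg (restrictedProduct.proj K ε hε S n) hg
      rw [map_sum, map_one] at this
      exact this
    have hne : (Finset.univ : Finset ι).Nonempty := by
      by_contra hcon
      rw [Finset.not_nonempty_iff_eq_empty.mp hcon] at h1
      simp at h1
    obtain ⟨i, -, hi⟩ := IsUltrametricDist.exists_norm_finsetSum_le_of_nonempty hne
      fun i => (g i).1 n * (b i).1 n
    rw [h1, norm_one, norm_mul] at hi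
    have h0 : (b i).1 n ≠ 0 := fun h0 => by simp [h0] at hi; linarith
    refine ⟨i, h0, le_trans ?_ ((hC i n).trans (hD ⟨i, rfl⟩))⟩
    refine Real.rpow_le_rpow (norm_nonneg _) ?_ (hε n).le
    rwa [norm_inv, inv_le_iff_one_le_mul₀ (norm_pos_iff.mpr h0)]
  · rintro ⟨C, hC⟩
    choose i h0 hi using hC
    refine ⟨fun k => ⟨fun n => if i n = k then ((b k).1 n)⁻¹ else 0,
      (mem_restrictedProduct K ε hε S _).mpr ⟨max C 0, fun n => ?_⟩⟩, ?_⟩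
    · by_cases h : i n = k
      · subst h
        simpa using Or.inl (hi n)
      · simp [h, Real.zero_rpow (hε n).ne']
    · ext n
      change (restrictedProduct.proj K ε hε S n) _ = _
      rw [map_sum]
      change ∑ k, (if i n = k then ((b k).1 n)⁻¹ else 0) * (b k).1 n = 1
      simp [ite_mul, h0]

end BoundedProduct

/-- The bound on the height in terms of the values of local equations. -/
theorem coe_mul_iInf_log_le_iff {ι K : Type*} [Finite ι] [NormedField K] (a : ι → K) {e : ℝ}
    (he : 0 < e) (C : ℝ) :
    (e : EReal) * (⨅ i, ENNReal.log (‖a i‖ₑ⁻¹)) ≤ (C : EReal) ↔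
      ∃ i, a i ≠ 0 ∧ ‖(a i)⁻¹‖ ^ e ≤ Real.exp C := by
  have h1 : ∀ i, (e : EReal) * ENNReal.log (‖a i‖ₑ⁻¹) ≤ (C : EReal) ↔
      a i ≠ 0 ∧ ‖(a i)⁻¹‖ ^ e ≤ Real.exp C := by
    intro i
    rw [← ENNReal.log_rpow, ← Real.log_exp C, ← ENNReal.log_ofReal_of_pos (Real.exp_pos C),
      ENNReal.log_le_log_iff, Real.log_exp]
    by_cases h0 : a i = 0
    · simp [h0, ENNReal.top_rpow_of_pos he]
    · rw [← enorm_inv h0, ← ofReal_norm, ENNReal.ofReal_rpow_of_nonneg (norm_nonneg _) he.le,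
        ENNReal.ofReal_le_ofReal_iff (Real.exp_pos C).le]
      simp [h0]
  simp_rw [← h1]
  constructor
  · intro h
    -- An empty infimum is `⊤`, which violates the bound; otherwise the finite infimum is attained.
    rcases isEmpty_or_nonempty ι with hι | hι
    · rw [iInf_of_empty, EReal.coe_mul_top_of_pos he] at h
      simp at h
    · obtain ⟨i, hi⟩ := exists_eq_ciInf_of_finite (f := fun i => ENNReal.log (‖a i‖ₑ⁻¹))
      exact ⟨i, hi ▸ h⟩
  · rintro ⟨i, hi⟩
    refine le_trans ?_ hi
    exact mul_le_mul_of_nonneg_left (iInf_le _ i) (by exact_mod_cast he.le)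

/-! ### Families of points with centers in a chart, and gluing over a partition. -/

section Family

variable {K : ℕ → Type} [∀ n, NormedField (K n)] [∀ n, IsUltrametricDist (K n)]
  [∀ n, Algebra ℂ (K n)] [∀ n, TriviallyValued (K n)] (ε : ℕ → ℝ) (hε : ∀ n, 0 < ε n)

/-- Evaluation of sections at a family of points with centers in `U`. -/
def evalFamily {X : Scheme.{0}} (p : ∀ n, Spec (.of (K n)) ⟶ X) {c : ℕ → X}
    (hc : ∀ n, IsCenter (p n) (c n)) (U : X.Opens) (S : Set ℕ) (hS : ∀ n : S, c n ∈ U) :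
    Γ(X, U) →+* restrictedProduct K ε hε S :=
  (RingHom.pi fun n : S => evalAt (p n) ((hc n).mem (hS n))).codRestrict _ fun g =>
    (mem_restrictedProduct K ε hε S _).mpr ⟨1, fun n =>
      Real.rpow_le_one (norm_nonneg _) ((hc n).norm_evalAt_le_one (hS n) g) (hε n).le⟩

theorem SpecMap_proj_evalFamily {X : Scheme.{0}} (p : ∀ n, Spec (.of (K n)) ⟶ X) {c : ℕ → X}
    (hc : ∀ n, IsCenter (p n) (c n)) (U : X.Opens) (hU : IsAffineOpen U) (S : Set ℕ)
    (hS : ∀ n : S, c n ∈ U) (n : S) :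
    Spec.map (CommRingCat.ofHom (restrictedProduct.proj K ε hε S n)) ≫
      Spec.map (CommRingCat.ofHom (evalFamily ε hε p hc U S hS)) ≫ hU.fromSpec = p n := by
  rw [← Spec.map_comp_assoc, ← CommRingCat.ofHom_comp]
  exact SpecMap_evalAt_fromSpec (p n) _ hU

theorem SpecMap_proj_restrict (S : Set ℕ) (n : S) :
    Spec.map (CommRingCat.ofHom (restrictedProduct.proj K ε hε S n)) ≫
      Spec.map (CommRingCat.ofHom (boundedProduct.restrict K ε hε S)) =
      Spec.map (CommRingCat.ofHom (boundedProduct.proj K ε hε n).toRingHom) := by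
  rw [← Spec.map_comp, ← CommRingCat.ofHom_comp]
  rfl

theorem SpecMap_proj_merge {ι : Type} [Finite ι] (c : ℕ → ι) (n : ℕ) :
    Spec.map (CommRingCat.ofHom (boundedProduct.proj K ε hε n).toRingHom) ≫
      Spec.map (CommRingCat.ofHom (boundedProduct.merge K ε hε c)) =
      Spec.map (CommRingCat.ofHom (restrictedProduct.proj K ε hε {m | c m = c n} ⟨n, rfl⟩)) ≫
        Spec.map (CommRingCat.ofHom
          (Pi.evalRingHom (fun i => restrictedProduct K ε hε {m | c m = i}) (c n))) := by
  rw [← Spec.map_comp, ← CommRingCat.ofHom_comp, ← Spec.map_comp, ← CommRingCat.ofHom_comp]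
  rfl

/-- Compatible points over the parts of a finite partition of the indices glue. -/
theorem exists_point_of_partition {X : Scheme.{0}} {f : X ⟶ Spec (.of ℂ)}
    (x : ∀ n, Point f (K n)) {ι : Type} [Finite ι] (c : ℕ → ι)
    (z : ∀ i, Spec (.of (restrictedProduct K ε hε {n | c n = i})) ⟶ X)
    (hz : ∀ n, Spec.map (CommRingCat.ofHom (restrictedProduct.proj K ε hε {m | c m = c n} ⟨n, rfl⟩)) ≫
      z (c n) = (x n).1) :
    ∃ y : Point f (boundedProduct K ε hε), ∀ n, y.map (boundedProduct.proj K ε hε n) = x n := by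
  obtain ⟨w, hw⟩ := exists_desc_Spec_pi _ z
  have h : ∀ n, Spec.map (CommRingCat.ofHom (boundedProduct.proj K ε hε n).toRingHom) ≫
      Spec.map (CommRingCat.ofHom (boundedProduct.merge K ε hε c)) ≫ w = (x n).1 := fun n => by
    rw [← Category.assoc, SpecMap_proj_merge, Category.assoc, hw, hz]
  refine ⟨⟨Spec.map (CommRingCat.ofHom (boundedProduct.merge K ε hε c)) ≫ w, ?_⟩,
    fun n => Subtype.ext (h n)⟩
  -- Compatibility with the maps to `Spec ℂ` can be tested on the factors.
  refine hom_ext_of_jointly_injective (fun n => (boundedProduct.proj K ε hε n).toRingHom)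
    (fun a ha => Subtype.ext (funext ha)) _ _ fun n => ?_
  rw [← Category.assoc, h, (x n).2, ← Spec.map_comp, ← CommRingCat.ofHom_comp]
  congr 2

end Family

end Degeneration

end

/-! ### The degeneration criterion. -/

theorem mainTheorem12
    (K : ℕ → Type) [∀ n, NormedField (K n)] [∀ n, IsUltrametricDist (K n)]
    [∀ n, CompleteSpace (K n)] [∀ n, IsAlgClosed (K n)]
    [∀ n, Algebra ℂ (K n)] [∀ n, Degeneration.TriviallyValued (K n)]
    (ε : ℕ → ℝ) (hε : ∀ n, 0 < ε n)
    (X : Scheme.{0}) [IsIntegral X] (f : X ⟶ Spec (.of ℂ))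
    (hX : Degeneration.IsQuasiProjective f)
    (x : ∀ n, Degeneration.Point f (K n))
    -- a compactification `X'` of `X`, and a presentation of its reduced boundary
    (X' : Scheme.{0}) [IsIntegral X'] (f' : X' ⟶ Spec (.of ℂ)) [IsProper f']
    (j : X ⟶ X') [IsOpenImmersion j] (hj : j ≫ f' = f)
    (P : Degeneration.SubschemePresentation (Degeneration.boundary j)) :
    (∃ y : Degeneration.Point f (Degeneration.boundedProduct K ε hε),
        ∀ n, y.map (Degeneration.boundedProduct.proj K ε hε n) = x n) ↔
      ∃ C : ℝ, ∀ n, (ε n : EReal) * P.height ((x n).1 ≫ j) ≤ (C : EReal) := by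
  open Degeneration in
  have : CompactSpace X' := QuasiCompact.compactSpace_of_compactSpace f'
  have : X'.IsSeparated := ⟨by
    rw [← Limits.terminal.comp_from f']
    infer_instance⟩
  let p n : Spec (.of (K n)) ⟶ X' := (x n).1 ≫ j
  have hp : ∀ n, ∃ c, IsCenter (p n) c := fun n =>
    exists_isCenter f' (p n) (by rw [Category.assoc, hj, (x n).2])
  choose c hc using hp
  choose chart hchart using exists_chart P
  obtain ⟨t, ht⟩ := isCompact_univ.elim_finite_subcover (fun x => ((chart x).U : Set X'))
    (fun x => (chart x).U.isOpen) (fun x _ => Set.mem_iUnion.mpr ⟨x, hchart x⟩)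
  have hidx : ∀ n, ∃ i : t, c n ∈ (chart i).U := fun n => by
    obtain ⟨i, hi, h⟩ := Set.mem_iUnion₂.mp (ht (Set.mem_univ (c n)))
    exact ⟨⟨i, hi⟩, h⟩
  choose idx hidx using hidx
  let S (i : t) : Set ℕ := {n | idx n = i}
  have hS : ∀ i (n : S i), c n ∈ (chart i).U := fun i n => by
    obtain ⟨n, rfl⟩ := n
    exact hidx n
  let χ (i : t) := evalFamily ε hε p hc (chart i).U (S i) (hS i)
  let z (i : t) := Spec.map (CommRingCat.ofHom (χ i)) ≫ (chart i).isAffineOpen.fromSpec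
  have hz : ∀ i (n : S i), Spec.map (CommRingCat.ofHom (restrictedProduct.proj K ε hε _ n)) ≫
      z i = p n := fun i n => SpecMap_proj_evalFamily ε hε p hc _ _ _ _ n
  have hheight : ∀ n (C : ℝ), (ε n : EReal) * P.height (p n) ≤ (C : EReal) ↔
      ∃ k, (χ (idx n) ((chart (idx n)).eq k)).1 ⟨n, rfl⟩ ≠ 0 ∧
        ‖((χ (idx n) ((chart (idx n)).eq k)).1 ⟨n, rfl⟩)⁻¹‖ ^ ε n ≤ Real.exp C := fun n C => by
    rw [P.height_eq (chart (idx n)) (hc n) (hidx n), coe_mul_iInf_log_le_iff _ (hε n)]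
    rfl
  constructor
  · rintro ⟨y, hy⟩
    have hrange : ∀ i, Set.range (z i) ⊆ Set.range j := fun i => by
      -- By separatedness the point built from the chart is the restriction of the given
      -- degeneration, so it lands in `X`.
      have : z i = (Spec.map (CommRingCat.ofHom (boundedProduct.restrict K ε hε (S i))) ≫ y.1) ≫
          j := by
        refine hom_ext_of_jointly_injective (restrictedProduct.proj K ε hε (S i))
          (fun a ha => Subtype.ext (funext ha)) _ _ fun n => ?_
        rw [hz, Category.assoc, ← Category.assoc, SpecMap_proj_restrict, ← Category.assoc]
        exact congrArg (fun q => q.1 ≫ j) (hy n).symm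
      rw [this]
      rintro _ ⟨b, rfl⟩
      exact ⟨_, rfl⟩
    have hC := fun i => (restrictedProduct.span_eq_top_iff K ε hε (S i) _).mp
      (((chart i).range_subset_iff (χ i)).mp (hrange i))
    choose C hC using hC
    obtain ⟨D, hD⟩ := (Set.finite_range C).bddAbove
    -- The maximum with `1` makes the argument of the logarithm positive.
    refine ⟨Real.log (max D 1), fun n => (hheight n _).mpr ?_⟩
    obtain ⟨k, h0, hk⟩ := hC (idx n) ⟨n, rfl⟩
    refine ⟨k, h0, hk.trans ?_⟩
    rw [Real.exp_log (by positivity)]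
    exact (hD ⟨_, rfl⟩).trans (le_max_left _ _)
  · rintro ⟨C, hC⟩
    have hrange : ∀ i, Set.range (z i) ⊆ Set.range j := fun i => by
      refine ((chart i).range_subset_iff (χ i)).mpr
        ((restrictedProduct.span_eq_top_iff K ε hε (S i) _).mpr ⟨Real.exp C, ?_⟩)
      rintro ⟨n, rfl⟩
      exact (hheight n C).mp (hC n)
    refine exists_point_of_partition ε hε x idx
      (fun i => IsOpenImmersion.lift j (z i) (hrange i)) fun n => ?_
    rw [← cancel_mono j, Category.assoc, IsOpenImmersion.lift_fac]
    exact hz (idx n) ⟨n, rfl⟩
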